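/- **Setting.** For a system $dx_t=f_0(x_t,t)\,dt+\varepsilon g(x_t,t,\varepsilon)\,dt+\varepsilon\sigma(x_t,t)\,dW_t$ (Itô sense, $\varepsilon\ge 0$, $W$ a Wiener process) on $[t_0,t_1]$ with deterministic initial condition $x_{t_0}=x_0$, call the system admissible if $f_0,g,\sigma$ are smooth with bounded first and second derivatives, $g$ is bounded, and $f_0+\varepsilon g$, $\varepsilon\sigma$ satisfy a linear growth and a Lipschitz condition (in each case uniformly in $x$, in $t\in[t_0,t_1]$ and in small $\varepsilon$). Let $F_s^t$ be the flow map of the idealized model $\dot x=f_0(x,t)$, $x^0_t=F_{t_0}^t(x_0)$, $\phi_s^t=\nabla F_s^t(x^0_s)$, $C_s^t=(\phi_s^t)^T\phi_s^t$, $\Lambda_s^t$ the largest eigenvalue of $C_s^t$, and $$\Delta_\infty=\varepsilon\max_{s\in[t_0,t]}|g(x^0_s,s,0)|,\qquad \Delta_\infty^\sigma=\varepsilon^2\max_{s\in[t_0,t]}\mathrm{tr}\,[\sigma(x^0_s,s)^T\sigma(x^0_s,s)],$$ $$\mathrm{MS}_{t_0}^t(x_0;r)=\Big(\int_{t_0}^t\sqrt{\Lambda_s^t}\,ds\Big)^2+r\int_{t_0}^t\mathrm{tr}\,C_s^t\,ds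 .$$ Let $\eta$ be the leading-order coefficient of the solution in $\varepsilon$, i.e. the solution of $d\eta_t=\nabla f_0(x^0_t,t)\eta_t\,dt+g(x^0_t,t,0)\,dt+\sigma(x^0_t,t)\,dW_t$, $\eta_{t_0}=0$. The bound whose optimality is claimed is $$\varepsilon^2\,\mathbb E|\eta_t|^2\le \mathcal B(f_0,t_0,t,x_0,\Delta_\infty,\Delta_\infty^\sigma):=\Big(\int_{t_0}^t\sqrt{\Lambda_s^t}\,ds\Big)^2\Delta_\infty^2+\int_{t_0}^t\mathrm{tr}\,C_s^t\,ds\;\Delta_\infty^\sigma .$$ **Statement.** Let $A,b,\sigma,x_0\in\mathbb R$, $t_0<t_1$, and let $W$ be a scalar Wiener process on a probability space $(\Omega,P)$. Consider the scalar equation $dx_t=Ax_t\,dt+\varepsilon b\,dt+\varepsilon\sigma\,dW_t$, $x_{t_0}=x_0$, on $[t_0,t_1]$. This system is admissible, the equation has a solution $x^\varepsilon$ for every $\varepsilon\ge0$, the equation for $\eta$ has a solution, and $\Delta_\infty=\varepsilon|b|$, $\Delta_\infty^\sigma=\varepsilon^2\sigma^2$. Moreover, for all $\varepsilon\ge 0$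 and $t\in[t_0,t_1]$ and for all such solutions: 1. $|x_t^\varepsilon-x_t^0|^2$ is integrable; if $A\neq0$, then $$\mathbb E|x_t^\varepsilon-x_t^0|^2=\frac{\varepsilon^2b^2}{A^2}\big(e^{A(t-t_0)}-1\big)^2+\frac{\varepsilon^2\sigma^2}{2A}\big(e^{2A(t-t_0)}-1\big);$$ and if $b\ne0$, then $\mathbb E|x_t^\varepsilon-x_t^0|^2=\varepsilon^2b^2\,\mathrm{MS}_{t_0}^t(x_0;\sigma^2/b^2)$. 2. (The bound is attained.) $|\eta_t|^2$ is integrable and $\varepsilon^2\,\mathbb E|\eta_t|^2=\mathcal B(f_0,t_0,t,x_0,\Delta_\infty,\Delta_\infty^\sigma)$, with $f_0(x,t)=Ax$. 3. (The bound cannot be improved.) If $\Phi$ is any real function such that $\varepsilon^2\,\mathbb E|\eta_t|^2\le\Phi(f_0,t_0,t,x_0,\Delta_\infty,\Delta_\infty^\sigma)$ for all admissible scalar systems driven by a Wiener process on $(\Omega,P)$ (in particular, if this holds for general systems), all initial conditions, all time intervals and all $\varepsilon\ge 0$, then for $f_0(x,t)=Ax$ one has $\mathcal B(f_0,t_0,t,x_0,\Delta,\Delta^\sigma)\le\Phi(f_0,t_0,t,x_0,\Delta,\Delta^\sigma)$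 for all $t\in[t_0,t_1]$ and all $\Delta,\Delta^\sigma\ge0$. In particular, if $c\,\mathcal B$ is such a valid bound for a constant $c\in\mathbb R$, then $c\ge1$. -/

import Mathlib

open MeasureTheory ProbabilityTheory Filter Set
open scoped NNReal ENNReal Topology

noncomputable section

namespace ModelSensitivity

/-! Throughout, the phase space `E` is a finite-dimensional real inner product space; for `E = ℝ`
one gets scalar equations. -/

section Deterministic

variable {E : Type*} [NormedAddCommGroup E] [InnerProductSpace ℝ E] [FiniteDimensional ℝ E]

/-- The coefficients of `dx = f₀(x,t) dt + ε g(x,t,ε) dt + ε σ(x,t) dW`. -/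
structure System (E : Type*) [NormedAddCommGroup E] [InnerProductSpace ℝ E] where
  /-- the idealized model -/
  f₀ : E → ℝ → E
  /-- the deterministic modeling error -/
  g : E → ℝ → ℝ → E
  /-- the coefficient of the noise -/
  σ : E → ℝ → (E →L[ℝ] E)

/-- `γ` solves `γ' = f(γ, τ)` on `[s, t]` with `γ s = x`. -/
def IsODESolution (f : E → ℝ → E) (s t : ℝ) (x : E) (γ : ℝ → E) : Prop :=
  γ s = x ∧ ∀ τ ∈ Icc s t, HasDerivWithinAt γ (f (γ τ) τ) (Icc s t) τ

open Classical in
/-- The flow map `F_s^t` of `x' = f(x, t)` for `s ≤ t` (and `x` itself where no solution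
exists). -/
def flow (f : E → ℝ → E) (s t : ℝ) (x : E) : E :=
  if h : ∃ γ : ℝ → E, IsODESolution f s t x γ then h.choose t else x

/-- The deformation gradient `φ_s^t(x) = ∇F_s^t(x)`. -/
def deformationGradient (f : E → ℝ → E) (s t : ℝ) (x : E) : E →L[ℝ] E :=
  fderiv ℝ (flow f s t) x

/-- The right Cauchy–Green strain tensor `C_s^t(x) = φ_s^t(x)ᵀ φ_s^t(x)`. -/
def cauchyGreen (f : E → ℝ → E) (s t : ℝ) (x : E) : E →ₗ[ℝ] E :=
  LinearMap.adjoint (deformationGradient f s t x : E →ₗ[ℝ] E) ∘ₗ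
    (deformationGradient f s t x : E →ₗ[ℝ] E)

/-- The largest eigenvalue of a (symmetric) endomorphism. -/
def largestEigenvalue (C : E →ₗ[ℝ] E) : ℝ :=
  sSup {μ : ℝ | Module.End.HasEigenvalue C μ}

/-- `∫_{t₀}^t √Λ_s^t(x⁰(s)) ds`, where `x⁰(s) = F_{t₀}^s(x₀)` is the idealized trajectory. -/
def stretchIntegral (f : E → ℝ → E) (t₀ t : ℝ) (x₀ : E) : ℝ :=
  ∫ s in t₀..t, √(largestEigenvalue (cauchyGreen f s t (flow f t₀ s x₀)))

/-- `∫_{t₀}^t tr C_s^t(x⁰(s)) ds`. -/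
def traceIntegral (f : E → ℝ → E) (t₀ t : ℝ) (x₀ : E) : ℝ :=
  ∫ s in t₀..t, LinearMap.trace ℝ E (cauchyGreen f s t (flow f t₀ s x₀))

/-- The model sensitivity `MS_{t₀}^t(x₀; r)`. -/
def MS (f : E → ℝ → E) (t₀ t : ℝ) (x₀ : E) (r : ℝ) : ℝ :=
  stretchIntegral f t₀ t x₀ ^ 2 + r * traceIntegral f t₀ t x₀

/-- The bound `(∫ √Λ)² Δ² + (∫ tr C) Δσ` on the mean-squared leading-order trajectory uncertainty,
as a function of the idealized model, the time interval, the initial condition and the sizes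
`Δ`, `Δσ` of the deterministic and of the stochastic model uncertainty. -/
def leadingBound (f : E → ℝ → E) (t₀ t : ℝ) (x₀ : E) (Δ Δσ : ℝ) : ℝ :=
  stretchIntegral f t₀ t x₀ ^ 2 * Δ ^ 2 + traceIntegral f t₀ t x₀ * Δσ

/-- `Δ_∞(x₀, t) = ε max_{s ∈ [t₀, t]} |g(x⁰(s), s; 0)|`. -/
def System.modelUncertainty (S : System E) (ε t₀ t : ℝ) (x₀ : E) : ℝ :=
  ε * sSup ((fun s ↦ ‖S.g (flow S.f₀ t₀ s x₀) s 0‖) '' Icc t₀ t)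

/-- `Δ_∞^σ(x₀, t) = ε² max_{s ∈ [t₀, t]} tr[σ(x⁰(s), s)ᵀ σ(x⁰(s), s)]`. -/
def System.noiseUncertainty (S : System E) (ε t₀ t : ℝ) (x₀ : E) : ℝ :=
  ε ^ 2 * sSup ((fun s ↦ LinearMap.trace ℝ E
    (LinearMap.adjoint (S.σ (flow S.f₀ t₀ s x₀) s : E →ₗ[ℝ] E) ∘ₗ
      (S.σ (flow S.f₀ t₀ s x₀) s : E →ₗ[ℝ] E))) '' Icc t₀ t)

/-- The standing assumptions on the coefficients over the time interval `[t₀, t₁]`. -/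
structure System.Admissible (S : System E) (t₀ t₁ : ℝ) : Prop where
  smooth_f₀ : ContDiff ℝ (⊤ : ℕ∞) (fun p : E × ℝ ↦ S.f₀ p.1 p.2)
  smooth_g : ContDiff ℝ (⊤ : ℕ∞) (fun p : E × ℝ × ℝ ↦ S.g p.1 p.2.1 p.2.2)
  smooth_σ : ContDiff ℝ (⊤ : ℕ∞) (fun p : E × ℝ ↦ S.σ p.1 p.2)
  /-- linear growth and Lipschitz condition for small `ε` -/
  growth_lipschitz : ∃ C > 0, ∃ D > 0, ∃ ε₀ > 0, ∀ ε ∈ Ioo (0 : ℝ) ε₀, ∀ t ∈ Icc t₀ t₁,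
    (∀ x, ‖S.f₀ x t + ε • S.g x t ε‖ + ‖ε • S.σ x t‖ ≤ C * (1 + ‖x‖)) ∧
    (∀ x y, ‖S.f₀ x t + ε • S.g x t ε - S.f₀ y t - ε • S.g y t ε‖ +
      ‖ε • S.σ x t - ε • S.σ y t‖ ≤ D * ‖x - y‖)
  /-- the deterministic modeling error is bounded -/
  bounded_g : ∃ K, ∃ ε₀ > 0, ∀ ε ∈ Icc (0 : ℝ) ε₀, ∀ t ∈ Icc t₀ t₁, ∀ x, ‖S.g x t ε‖ ≤ K
  /-- the first and second derivatives of the coefficients are bounded -/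
  bounded_deriv_f₀ : ∃ K, ∀ t ∈ Icc t₀ t₁, ∀ x : E, ∀ k ∈ Icc 1 2,
    ‖iteratedFDeriv ℝ k (fun p : E × ℝ ↦ S.f₀ p.1 p.2) (x, t)‖ ≤ K
  bounded_deriv_g : ∃ K, ∃ ε₀ > 0, ∀ ε ∈ Icc (0 : ℝ) ε₀, ∀ t ∈ Icc t₀ t₁, ∀ x : E,
    ∀ k ∈ Icc 1 2, ‖iteratedFDeriv ℝ k (fun p : E × ℝ × ℝ ↦ S.g p.1 p.2.1 p.2.2) (x, t, ε)‖ ≤ K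
  bounded_deriv_σ : ∃ K, ∀ t ∈ Icc t₀ t₁, ∀ x : E, ∀ k ∈ Icc 1 2,
    ‖iteratedFDeriv ℝ k (fun p : E × ℝ ↦ S.σ p.1 p.2) (x, t)‖ ≤ K

end Deterministic

section Stochastic

variable {Ω : Type*} [MeasurableSpace Ω]
variable {E : Type*} [NormedAddCommGroup E] [InnerProductSpace ℝ E] [FiniteDimensional ℝ E]
  [MeasurableSpace E] [BorelSpace E]

/-- The increments of `W` after time `t₀` form a standard Wiener process in `E`: the coordinates
in an orthonormal basis are independent real Brownian motions. -/
structure IsWiener (P : Measure Ω) (t₀ : ℝ) (W : ℝ → Ω → E) : Prop where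
  measurable : ∀ t, t₀ ≤ t → Measurable (W t)
  brownian : ∀ i, IsBrownianReal
    (fun (s : ℝ≥0) ω ↦ inner ℝ (stdOrthonormalBasis ℝ E i) (W (t₀ + s) ω - W t₀ ω)) P
  indep : iIndepFun
    (fun i ω (s : ℝ≥0) ↦ inner ℝ (stdOrthonormalBasis ℝ E i) (W (t₀ + s) ω - W t₀ ω)) P

/-- The σ-algebra generated by the increments of `W` on `[t₀, t]`. -/
abbrev noiseSigmaAlgebra (W : ℝ → Ω → E) (t₀ t : ℝ) : MeasurableSpace Ω :=
  ⨆ s ∈ Icc t₀ t, MeasurableSpace.comap (fun ω ↦ W s ω - W t₀ ω) inferInstance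

/-- `I = ∫_a^t H dW` in the sense of Itô, for an adapted integrand `H` with continuous paths:
along every sequence of partitions `a = p k 0 ≤ p k 1 ≤ ⋯ ≤ p k (N k) = t` whose mesh tends to
zero, the left-endpoint sums converge to `I` in probability. -/
def IsItoIntegral (P : Measure Ω) (W : ℝ → Ω → E) (H : ℝ → Ω → (E →L[ℝ] E)) (a t : ℝ)
    (I : Ω → E) : Prop :=
  ∀ (N : ℕ → ℕ) (p : ℕ → ℕ → ℝ), (∀ k, Monotone (p k)) → (∀ k, p k 0 = a) →
    (∀ k, p k (N k) = t) →
    (∀ δ > 0, ∀ᶠ k in atTop, ∀ i < N k, p k (i + 1) - p k i < δ) →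
    TendstoInMeasure P
      (fun k ω ↦ ∑ i ∈ Finset.range (N k), H (p k i) ω (W (p k (i + 1)) ω - W (p k i) ω)) atTop I

/-- `x` is a (strong) solution on `[t₀, t₁]` of `dx = a(x,t) dt + B(x,t) dW`, `x_{t₀} = x₀`, for
continuous coefficients `a`, `B`; adaptedness is to the `P`-completed filtration of the noise. -/
structure IsSDESolution (P : Measure Ω) (W : ℝ → Ω → E) (t₀ t₁ : ℝ) (a : E → ℝ → E)
    (B : E → ℝ → (E →L[ℝ] E)) (x₀ : E) (x : ℝ → Ω → E) : Prop where
  adapted : ∀ t ∈ Icc t₀ t₁, AEStronglyMeasurable[noiseSigmaAlgebra W t₀ t] (x t) P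
  continuous_paths : ∀ᵐ ω ∂P, ContinuousOn (fun t ↦ x t ω) (Icc t₀ t₁)
  initial : ∀ᵐ ω ∂P, x t₀ ω = x₀
  equation : ∀ t ∈ Icc t₀ t₁, IsItoIntegral P W (fun s ω ↦ B (x s ω) s) t₀ t
    (fun ω ↦ x t ω - x₀ - ∫ s in t₀..t, a (x s ω) s)

/-- `x` is the true trajectory `x^ε`: it solves
`dx = f₀(x,t) dt + ε g(x,t,ε) dt + ε σ(x,t) dW`, `x_{t₀} = x₀`. -/
def System.IsTrajectory (S : System E) (P : Measure Ω) (W : ℝ → Ω → E) (ε t₀ t₁ : ℝ) (x₀ : E)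
    (x : ℝ → Ω → E) : Prop :=
  IsSDESolution P W t₀ t₁ (fun y s ↦ S.f₀ y s + ε • S.g y s ε) (fun y s ↦ ε • S.σ y s) x₀ x

/-- `η` is the leading-order coefficient of `x^ε` in `ε`: it solves
`dη = ∇f₀(x⁰_t,t) η dt + g(x⁰_t,t;0) dt + σ(x⁰_t,t) dW`, `η_{t₀} = 0`. -/
def System.IsLeadingOrder (S : System E) (P : Measure Ω) (W : ℝ → Ω → E) (t₀ t₁ : ℝ) (x₀ : E)
    (η : ℝ → Ω → E) : Prop :=
  IsSDESolution P W t₀ t₁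
    (fun y s ↦ fderiv ℝ (fun z ↦ S.f₀ z s) (flow S.f₀ t₀ s x₀) y + S.g (flow S.f₀ t₀ s x₀) s 0)
    (fun _ s ↦ S.σ (flow S.f₀ t₀ s x₀) s) 0 η

/-- `Φ`, a function of the idealized model, the time interval, the initial condition and the sizes
`Δ_∞`, `Δ_∞^σ` of the model uncertainty, bounds the mean-squared leading-order trajectory
uncertainty `ε² 𝔼|η_t|²` of every admissible system on the phase space `E` driven by a Wiener
process on `(Ω, P)`. -/
def IsUniversalBound (P : Measure Ω) (Φ : (E → ℝ → E) → ℝ → ℝ → E → ℝ → ℝ → ℝ) : Prop :=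
  ∀ (S : System E) (t₀ t₁ : ℝ) (x₀ : E) (W η : ℝ → Ω → E),
    t₀ < t₁ → S.Admissible t₀ t₁ → IsWiener P t₀ W → S.IsLeadingOrder P W t₀ t₁ x₀ η →
    ∀ ε, 0 ≤ ε → ∀ t ∈ Icc t₀ t₁,
      ε ^ 2 * ∫ ω, ‖η t ω‖ ^ 2 ∂P ≤
        Φ S.f₀ t₀ t x₀ (S.modelUncertainty ε t₀ t x₀) (S.noiseUncertainty ε t₀ t x₀)

end Stochastic

/-- The scalar linear system `dx = A x dt + ε b dt + ε σ dW`. -/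
def scalarLinear (A b σ : ℝ) : System ℝ where
  f₀ x _ := A * x
  g _ _ _ := b
  σ _ _ := σ • ContinuousLinearMap.id ℝ ℝ

end ModelSensitivity

end

/-! The flow of `x' = A x` is multiplication by `e^{A(t-s)}`, so `√Λ_s^t = e^{A(t-s)}` and `tr C_s^t
= e^{2A(t-s)}` at every base point. Put `G = ∫ e^{A(t-s)} ds` and `Z = ∫ e^{A(t-s)} dW_s`. Variation
of constants gives `η = b G + σ Z` and `x^ε - x^0 = ε (b G + σ Z)`. Since `Z` is centred with
variance `∫ e^{2A(t-s)} ds`, the cross term vanishes and the mean square of `η` is `b² G² + σ² ∫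
e^{2A(t-s)} ds`. After multiplication by `ε²` this is the bound itself.

Almost no stochastic calculus is needed, because the noise coefficient is constant. The Itô sums
telescope (`isItoIntegral_const_iff`), so the equation holds path by path as an integral equation
driven by a continuous path `w`. Subtracting `γ w` leaves an ordinary linear equation, solved by
Duhamel's formula (`noiseResponse_integral_eq`, `eq_noiseResponse_of_integral_eq`), and `Z` becomes
`noiseResponse`. Its variance follows from the Brownian covariance `min s r - t₀` by Fubini and
integration by parts (`IsWiener.noiseResponse_moments`, `noiseResponse_variance_eq`).

Optimality follows from equality: every pair of sizes `Δ, Δσ ≥ 0` is realised by such a system, so a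
universal bound must dominate the attained value there. -/

namespace ModelSensitivity

/-! ### Flow, Cauchy–Green tensor and sensitivity integrals of `x' = A x`. -/

section LinearFlow

theorem hasDerivAt_exp_mul_sub (A a τ : ℝ) :
    HasDerivAt (fun τ ↦ Real.exp (A * (τ - a))) (A * Real.exp (A * (τ - a))) τ := by
  have h : HasDerivAt (fun τ ↦ A * (τ - a)) A τ := by
    simpa using ((hasDerivAt_id τ).sub_const a).const_mul A
  simpa [mul_comm] using h.exp

theorem hasDerivAt_exp_mul_sub_left (A t τ : ℝ) :
    HasDerivAt (fun τ ↦ Real.exp (A * (t - τ))) (-(A * Real.exp (A * (t - τ)))) τ := by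
  have h : HasDerivAt (fun τ ↦ A * (t - τ)) (-A) τ := by
    simpa using ((hasDerivAt_id τ).const_sub t).const_mul A
  simpa [mul_comm] using h.exp

/-- `flow` evaluates an arbitrarily chosen solution, so uniqueness is needed as well as existence.
The integrating factor supplies it: `e^{A(s-τ)} γ τ` has zero derivative on `[s, t]`. -/
theorem flow_linear (A : ℝ) {s t : ℝ} (hst : s ≤ t) (x : ℝ) :
    flow (fun y _ ↦ A * y) s t x = Real.exp (A * (t - s)) * x := by
  have hex : ∃ γ : ℝ → ℝ, IsODESolution (fun y _ ↦ A * y) s t x γ := by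
    refine ⟨fun τ ↦ Real.exp (A * (τ - s)) * x, by simp, fun τ _ ↦ ?_⟩
    have h := ((hasDerivAt_exp_mul_sub A s τ).mul_const x).hasDerivWithinAt (s := Icc s t)
    exact h.congr_deriv (by ring)
  rw [flow, dif_pos hex]
  obtain ⟨h0, hd⟩ := hex.choose_spec
  set γ := hex.choose
  have hd' : ∀ τ ∈ Icc s t,
      HasDerivWithinAt (fun τ ↦ Real.exp (A * (s - τ)) * γ τ) 0 (Icc s t) τ := fun τ hτ ↦ by
    refine ((hasDerivAt_exp_mul_sub_left A s τ).hasDerivWithinAt.mul (hd τ hτ)).congr_deriv ?_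
    ring
  have hc := constant_of_has_deriv_right_zero (fun τ hτ ↦ (hd' τ hτ).continuousWithinAt)
    (fun τ hτ ↦ (hd' τ (Ico_subset_Icc_self hτ)).mono_of_mem_nhdsWithin
      (Icc_mem_nhdsGE_of_mem hτ)) t (right_mem_Icc.2 hst)
  simp only [sub_self, mul_zero, Real.exp_zero, one_mul, h0] at hc
  rw [← hc, ← mul_assoc, ← Real.exp_add]
  simp [← mul_add]

theorem deformationGradient_linear (A : ℝ) {s t : ℝ} (hst : s ≤ t) (x : ℝ) :
    deformationGradient (fun y _ ↦ A * y) s t x =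
      Real.exp (A * (t - s)) • ContinuousLinearMap.id ℝ ℝ := by
  have h : flow (fun y _ ↦ A * y) s t = fun x ↦ Real.exp (A * (t - s)) * x :=
    funext fun x ↦ flow_linear A hst x
  rw [deformationGradient, h]
  ext
  simp

theorem adjoint_comp_smul_id (c : ℝ) :
    LinearMap.adjoint ((c • ContinuousLinearMap.id ℝ ℝ : ℝ →L[ℝ] ℝ) : ℝ →ₗ[ℝ] ℝ) ∘ₗ
      ((c • ContinuousLinearMap.id ℝ ℝ : ℝ →L[ℝ] ℝ) : ℝ →ₗ[ℝ] ℝ) = c ^ 2 • LinearMap.id := by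
  have h : ((c • ContinuousLinearMap.id ℝ ℝ : ℝ →L[ℝ] ℝ) : ℝ →ₗ[ℝ] ℝ) = c • LinearMap.id := by
    ext; simp
  have h' : LinearMap.adjoint (LinearMap.id : ℝ →ₗ[ℝ] ℝ) = LinearMap.id :=
    LinearMap.adjoint_id
  rw [h, map_smulₛₗ, h']
  ext
  simp [sq]

theorem trace_smul_id_real (c : ℝ) :
    LinearMap.trace ℝ ℝ (c • LinearMap.id : ℝ →ₗ[ℝ] ℝ) = c := by
  simp

theorem largestEigenvalue_smul_id_real (c : ℝ) :
    largestEigenvalue (c • LinearMap.id : ℝ →ₗ[ℝ] ℝ) = c := by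
  have h : {μ : ℝ | Module.End.HasEigenvalue (c • LinearMap.id : ℝ →ₗ[ℝ] ℝ) μ} = {c} := by
    ext μ
    simp only [mem_ofPred_eq, mem_singleton_iff]
    constructor
    · intro hμ
      obtain ⟨v, hv⟩ := hμ.exists_hasEigenvector
      have h1 := hv.apply_eq_smul
      simp only [LinearMap.smul_apply, LinearMap.id_coe, id_eq, smul_eq_mul] at h1
      exact (mul_right_cancel₀ hv.2 h1).symm
    · rintro rfl
      refine Module.End.hasEigenvalue_of_hasEigenvector (x := (1 : ℝ)) ⟨?_, one_ne_zero⟩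
      simp
  rw [largestEigenvalue, h, csSup_singleton]

/-- The tensor is a scalar multiple of the identity on a line, so its trace and its largest
eigenvalue coincide; it does not depend on the base point. -/
theorem cauchyGreen_linear (A : ℝ) {s t : ℝ} (hst : s ≤ t) (x : ℝ) :
    cauchyGreen (fun y _ ↦ A * y) s t x =
      (Real.exp (2 * A * (t - s)) • LinearMap.id : ℝ →ₗ[ℝ] ℝ) := by
  rw [cauchyGreen, deformationGradient_linear A hst, adjoint_comp_smul_id, ← Real.exp_nat_mul]
  congr 2
  push_cast
  ring

theorem stretchIntegral_linear (A : ℝ) {t₀ t : ℝ} (ht : t₀ ≤ t) (x₀ : ℝ) :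
    stretchIntegral (fun y _ ↦ A * y) t₀ t x₀ = ∫ s in t₀..t, Real.exp (A * (t - s)) := by
  refine intervalIntegral.integral_congr fun s hs ↦ ?_
  rw [uIcc_of_le ht] at hs
  rw [cauchyGreen_linear A hs.2, largestEigenvalue_smul_id_real, mul_assoc, two_mul, Real.exp_add,
    Real.sqrt_mul_self (Real.exp_pos _).le]

theorem traceIntegral_linear (A : ℝ) {t₀ t : ℝ} (ht : t₀ ≤ t) (x₀ : ℝ) :
    traceIntegral (fun y _ ↦ A * y) t₀ t x₀ = ∫ s in t₀..t, Real.exp (2 * A * (t - s)) := by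
  refine intervalIntegral.integral_congr fun s hs ↦ ?_
  rw [uIcc_of_le ht] at hs
  rw [cauchyGreen_linear A hs.2, trace_smul_id_real]

theorem integral_exp_mul_sub {A : ℝ} (hA : A ≠ 0) (t₀ t : ℝ) :
    ∫ s in t₀..t, Real.exp (A * (t - s)) = (Real.exp (A * (t - t₀)) - 1) / A := by
  have h : ∀ s ∈ uIcc t₀ t, HasDerivAt (fun s ↦ -(Real.exp (A * (t - s)) / A))
      (Real.exp (A * (t - s))) s := fun s _ ↦ by
    refine ((hasDerivAt_exp_mul_sub_left A t s).div_const A).neg.congr_deriv ?_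
    field_simp
  rw [intervalIntegral.integral_eq_sub_of_hasDerivAt h
    (Continuous.intervalIntegrable (by fun_prop) _ _)]
  simp
  ring

end LinearFlow

/-! ### Admissibility of the scalar linear system and the sizes of its uncertainty. -/

section ScalarLinear

theorem scalarLinear_admissible (A b σ t₀ t₁ : ℝ) : (scalarLinear A b σ).Admissible t₀ t₁ where
  smooth_f₀ := by simp only [scalarLinear]; fun_prop
  smooth_g := by simp only [scalarLinear]; fun_prop
  smooth_σ := by simp only [scalarLinear]; fun_prop
  growth_lipschitz := by
    refine ⟨|A| + |b| + |σ| + 1, by positivity, |A| + 1, by positivity, 1, one_pos,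
      fun ε hε t _ ↦ ⟨fun x ↦ ?_, fun x y ↦ ?_⟩⟩
    · have h1 : ‖A * x + ε • b‖ ≤ |A| * |x| + |b| := by
        refine (norm_add_le _ _).trans ?_
        simp only [norm_mul, smul_eq_mul, Real.norm_eq_abs, abs_of_pos hε.1]
        have := mul_le_of_le_one_left (abs_nonneg b) hε.2.le
        linarith
      have h2 : ‖ε • σ • ContinuousLinearMap.id ℝ ℝ‖ ≤ |σ| := by
        simp only [norm_smul, Real.norm_eq_abs, abs_of_pos hε.1, ContinuousLinearMap.norm_id,
          mul_one]
        exact mul_le_of_le_one_left (abs_nonneg σ) hε.2.le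
      simp only [scalarLinear, Real.norm_eq_abs x]
      have h3 : 0 ≤ (|b| + |σ| + 1) * |x| := by positivity
      have h4 := abs_nonneg A
      linarith
    · simp only [scalarLinear]
      have h : A * x + ε • b - A * y - ε • b = A * (x - y) := by ring
      rw [h, sub_self, norm_zero, add_zero, norm_mul, Real.norm_eq_abs A]
      have := norm_nonneg (x - y)
      linarith
  bounded_g := ⟨|b|, 1, one_pos, fun _ _ _ _ _ ↦ le_rfl⟩
  bounded_deriv_f₀ := by
    set L : ℝ × ℝ →L[ℝ] ℝ := A • ContinuousLinearMap.fst ℝ ℝ ℝ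
    have hL : (fun p : ℝ × ℝ ↦ (scalarLinear A b σ).f₀ p.1 p.2) = L := by
      ext p; simp [L, scalarLinear]
    refine ⟨‖L‖, fun t _ x k hk ↦ ?_⟩
    rw [hL]
    -- The derivative of a linear map is constant: order one has norm `‖L‖`, higher orders vanish.
    obtain ⟨k, rfl⟩ := Nat.exists_eq_add_of_le' hk.1
    have hf : fderiv ℝ L = fun _ ↦ L := funext fun _ ↦ L.fderiv
    rw [← norm_iteratedFDeriv_fderiv, hf]
    rcases k with _ | k
    · simp
    · simp [iteratedFDeriv_succ_const]
  bounded_deriv_g := by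
    refine ⟨0, 1, one_pos, fun ε _ t _ x k hk ↦ ?_⟩
    simp only [scalarLinear]
    rw [iteratedFDeriv_const_of_ne (Nat.one_le_iff_ne_zero.1 hk.1)]
    simp
  bounded_deriv_σ := by
    refine ⟨0, fun t _ x k hk ↦ ?_⟩
    simp only [scalarLinear]
    rw [iteratedFDeriv_const_of_ne (Nat.one_le_iff_ne_zero.1 hk.1)]
    simp

theorem scalarLinear_modelUncertainty (A b σ ε : ℝ) {t₀ t : ℝ} (ht : t₀ ≤ t) (x₀ : ℝ) :
    (scalarLinear A b σ).modelUncertainty ε t₀ t x₀ = ε * |b| := by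
  simp only [System.modelUncertainty, scalarLinear]
  rw [(nonempty_Icc.2 ht).image_const, csSup_singleton, Real.norm_eq_abs]

theorem scalarLinear_noiseUncertainty (A b σ ε : ℝ) {t₀ t : ℝ} (ht : t₀ ≤ t) (x₀ : ℝ) :
    (scalarLinear A b σ).noiseUncertainty ε t₀ t x₀ = ε ^ 2 * σ ^ 2 := by
  simp only [System.noiseUncertainty, scalarLinear]
  rw [(nonempty_Icc.2 ht).image_const, csSup_singleton, adjoint_comp_smul_id, trace_smul_id_real]

end ScalarLinear

/-! ### Duhamel's formula for a continuous forcing. -/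

section VariationOfConstants

theorem hasDerivAt_integral_right {f : ℝ → ℝ} (hf : Continuous f) (a t : ℝ) :
    HasDerivAt (fun t ↦ ∫ s in a..t, f s) (f t) t :=
  intervalIntegral.integral_hasDerivAt_right (hf.intervalIntegrable _ _)
    (hf.stronglyMeasurableAtFilter _ _) hf.continuousAt

/-- Moves the dependence on `t` out of the integrand, so that only the fundamental theorem of
calculus is needed to differentiate in `t`. -/
theorem exp_mul_sub_mul_integral (A a t : ℝ) (h : ℝ → ℝ) :
    ∫ s in a..t, Real.exp (A * (t - s)) * h s =
      Real.exp (A * (t - a)) * ∫ s in a..t, Real.exp (A * (a - s)) * h s := by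
  rw [← intervalIntegral.integral_const_mul]
  congr 1 with s
  rw [← mul_assoc, ← Real.exp_add]
  congr 2
  ring

/-- **Variation of constants**, existence: Duhamel's formula solves `y' = A y + h`. -/
theorem duhamel_integral_eq (A x₀ a : ℝ) {h : ℝ → ℝ} (hh : Continuous h) (t : ℝ) :
    Real.exp (A * (t - a)) * x₀ + ∫ s in a..t, Real.exp (A * (t - s)) * h s =
      x₀ + ∫ s in a..t, (A * (Real.exp (A * (s - a)) * x₀ +
        ∫ r in a..s, Real.exp (A * (s - r)) * h r) + h s) := by
  simp only [exp_mul_sub_mul_integral A a _ h]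
  set I : ℝ → ℝ := fun t ↦ ∫ s in a..t, Real.exp (A * (a - s)) * h s
  have hI : ∀ t, HasDerivAt I (Real.exp (A * (a - t)) * h t) t :=
    fun t ↦ hasDerivAt_integral_right (by fun_prop) a t
  have hIc : Continuous I := continuous_iff_continuousAt.2 fun t ↦ (hI t).continuousAt
  have hY : ∀ s ∈ uIcc a t, HasDerivAt
      (fun s ↦ Real.exp (A * (s - a)) * x₀ + Real.exp (A * (s - a)) * I s)
      (A * (Real.exp (A * (s - a)) * x₀ + Real.exp (A * (s - a)) * I s) + h s) s := fun s _ ↦ by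
    refine (((hasDerivAt_exp_mul_sub A a s).mul_const x₀).add
      ((hasDerivAt_exp_mul_sub A a s).mul (hI s))).congr_deriv ?_
    have : Real.exp (A * (s - a)) * Real.exp (A * (a - s)) = 1 := by
      rw [← Real.exp_add, ← mul_add]; simp
    linear_combination h s * this
  rw [intervalIntegral.integral_eq_sub_of_hasDerivAt hY
    (Continuous.intervalIntegrable (by fun_prop) _ _)]
  simp [I]

/-- **Variation of constants**, uniqueness: a solution of `y' = A y + h` is given by Duhamel's
formula. -/
theorem eq_duhamel_of_integral_eq {A x₀ a t : ℝ} (hat : a ≤ t) {y h : ℝ → ℝ} (hy : Continuous y)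
    (hh : Continuous h)
    (H : ∀ s ∈ Icc a t, y s = x₀ + ∫ r in a..s, (A * y r + h r)) :
    y t = Real.exp (A * (t - a)) * x₀ + ∫ s in a..t, Real.exp (A * (t - s)) * h s := by
  -- The right-hand side of the integral equation is differentiated instead of `y`: it is
  -- differentiable on the whole line, while `y` agrees with it only on `[a, t]`.
  have hz : ∀ s ∈ uIcc a t, HasDerivAt
      (fun s ↦ Real.exp (A * (a - s)) * (x₀ + ∫ r in a..s, (A * y r + h r)))
      (Real.exp (A * (a - s)) * h s) s := fun s hs ↦ by
    rw [uIcc_of_le hat] at hs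
    refine ((hasDerivAt_exp_mul_sub_left A a s).mul ((hasDerivAt_integral_right
      (f := fun r ↦ A * y r + h r) (by fun_prop) a s).const_add x₀)).congr_deriv ?_
    rw [← H s hs]
    ring
  have := intervalIntegral.integral_eq_sub_of_hasDerivAt hz
    (Continuous.intervalIntegrable (by fun_prop) _ _)
  rw [exp_mul_sub_mul_integral, this, ← H t (right_mem_Icc.2 hat)]
  have h1 : Real.exp (A * (t - a)) * Real.exp (A * (a - t)) = 1 := by
    rw [← Real.exp_add, ← mul_add]; simp
  simp only [sub_self, mul_zero, Real.exp_zero, intervalIntegral.integral_same]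
  linear_combination -y t * h1

end VariationOfConstants

/-- The response `w_t + A ∫_a^t e^{A(t-s)} w_s ds` of `x' = A x` to the noise path `w`, that is,
`∫_a^t e^{A(t-s)} dw_s` after an integration by parts. -/
noncomputable def noiseResponse (A a : ℝ) (w : ℝ → ℝ) (t : ℝ) : ℝ :=
  w t + A * ∫ s in a..t, Real.exp (A * (t - s)) * w s

/-! ### The linear equation driven by a fixed continuous path. -/

section Pathwise

/-- The substitution `x = γ w + y` turns `dx = (A x + β) dt + γ dw` into `y' = A y + (A γ w + β)`,
which makes sense for a merely continuous `w`. This is Duhamel's formula for `y` regrouped. -/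
theorem duhamel_noise (A a β γ x₀ t : ℝ) {w : ℝ → ℝ} (hw : Continuous w) :
    Real.exp (A * (t - a)) * x₀ + ∫ s in a..t, Real.exp (A * (t - s)) * (A * γ * w s + β) =
      Real.exp (A * (t - a)) * x₀ + β * (∫ s in a..t, Real.exp (A * (t - s))) +
        γ * noiseResponse A a w t - γ * w t := by
  have h : ∀ s, Real.exp (A * (t - s)) * (A * γ * w s + β) =
      A * γ * (Real.exp (A * (t - s)) * w s) + β * Real.exp (A * (t - s)) := fun s ↦ by ring
  simp only [h, noiseResponse]
  rw [intervalIntegral.integral_add (Continuous.intervalIntegrable (by fun_prop) _ _)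
    (Continuous.intervalIntegrable (by fun_prop) _ _), intervalIntegral.integral_const_mul,
    intervalIntegral.integral_const_mul]
  ring

theorem noiseResponse_congr {A a t : ℝ} (hat : a ≤ t) {v w : ℝ → ℝ} (h : EqOn v w (Icc a t)) :
    noiseResponse A a v t = noiseResponse A a w t := by
  rw [noiseResponse, noiseResponse, h (right_mem_Icc.2 hat)]
  congr 2
  refine intervalIntegral.integral_congr fun s hs ↦ ?_
  rw [uIcc_of_le hat] at hs
  simp only [h hs]

theorem continuous_integral_exp_mul_sub_mul (A a : ℝ) {h : ℝ → ℝ} (hh : Continuous h) :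
    Continuous fun t ↦ ∫ s in a..t, Real.exp (A * (t - s)) * h s := by
  simp only [exp_mul_sub_mul_integral A a _ h]
  have hI : Continuous fun t ↦ ∫ s in a..t, Real.exp (A * (a - s)) * h s :=
    continuous_iff_continuousAt.2 fun t ↦ (hasDerivAt_integral_right
      (f := fun s ↦ Real.exp (A * (a - s)) * h s) (by fun_prop) a t).continuousAt
  fun_prop

theorem continuous_noiseResponse (A a : ℝ) {w : ℝ → ℝ} (hw : Continuous w) :
    Continuous (noiseResponse A a w) :=
  hw.add ((continuous_integral_exp_mul_sub_mul A a hw).const_mul A)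

/-- The explicit solution of `dx = (A x + β) dt + γ dw` along a continuous path `w`. -/
theorem noiseResponse_integral_eq {A a b β γ x₀ t : ℝ} {w : ℝ → ℝ}
    (hw : ContinuousOn w (Icc a b)) (ht : t ∈ Icc a b) {x : ℝ → ℝ}
    (hx : ∀ s ∈ Icc a b, x s = Real.exp (A * (s - a)) * x₀ +
      β * (∫ r in a..s, Real.exp (A * (s - r))) + γ * noiseResponse A a w s) :
    x t - x₀ - ∫ s in a..t, (A * x s + β) = γ * w t := by
  have hab : a ≤ b := ht.1.trans ht.2
  -- Extending by constants outside the interval gives the global continuity that Duhamel's formula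
  -- asks for.
  set v : ℝ → ℝ := IccExtend hab ((Icc a b).domRestrict w)
  have hv : Continuous v := (continuousOn_iff_continuous_domRestrict.1 hw).Icc_extend'
  have hvw : EqOn v w (Icc a b) := fun s hs ↦ IccExtend_of_mem hab _ hs
  have hx' : ∀ s ∈ Icc a b, x s = γ * v s + (Real.exp (A * (s - a)) * x₀ +
      ∫ r in a..s, Real.exp (A * (s - r)) * (A * γ * v r + β)) := fun s hs ↦ by
    rw [duhamel_noise A a β γ x₀ s hv, hx s hs,
      noiseResponse_congr hs.1 (hvw.mono (Icc_subset_Icc_right hs.2))]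
    ring
  have h1 := duhamel_integral_eq A x₀ a (h := fun r ↦ A * γ * v r + β) (by fun_prop) t
  have h2 : ∫ s in a..t, (A * x s + β) = ∫ s in a..t, (A * (Real.exp (A * (s - a)) * x₀ +
      ∫ r in a..s, Real.exp (A * (s - r)) * (A * γ * v r + β)) + (A * γ * v s + β)) := by
    refine intervalIntegral.integral_congr fun s hs ↦ ?_
    rw [uIcc_of_le ht.1] at hs
    simp only [hx' s ⟨hs.1, hs.2.trans ht.2⟩]
    ring
  rw [h2, hx' t ht, h1, hvw ht]
  ring

theorem eq_noiseResponse_of_integral_eq {A a t β γ x₀ : ℝ} (hat : a ≤ t) {w x : ℝ → ℝ}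
    (hw : ContinuousOn w (Icc a t)) (hx : ContinuousOn x (Icc a t))
    (H : ∀ s ∈ Icc a t, x s - x₀ - ∫ r in a..s, (A * x r + β) = γ * w s) :
    x t = Real.exp (A * (t - a)) * x₀ + β * (∫ s in a..t, Real.exp (A * (t - s))) +
      γ * noiseResponse A a w t := by
  set v : ℝ → ℝ := IccExtend hat ((Icc a t).domRestrict w)
  have hv : Continuous v := (continuousOn_iff_continuous_domRestrict.1 hw).Icc_extend'
  have hvw : EqOn v w (Icc a t) := fun s hs ↦ IccExtend_of_mem hat _ hs
  set y : ℝ → ℝ := IccExtend hat ((Icc a t).domRestrict x)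
  have hy : Continuous y := (continuousOn_iff_continuous_domRestrict.1 hx).Icc_extend'
  have hyx : EqOn y x (Icc a t) := fun s hs ↦ IccExtend_of_mem hat _ hs
  have h1 := eq_duhamel_of_integral_eq (A := A) (x₀ := x₀) hat (y := fun s ↦ y s - γ * v s)
    (h := fun s ↦ A * γ * v s + β) (by fun_prop) (by fun_prop) fun s hs ↦ by
      have h2 : ∫ r in a..s, (A * (y r - γ * v r) + (A * γ * v r + β)) =
          ∫ r in a..s, (A * x r + β) := by
        refine intervalIntegral.integral_congr fun r hr ↦ ?_
        rw [uIcc_of_le hs.1] at hr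
        simp only [hyx ⟨hr.1, hr.2.trans hs.2⟩]
        ring
      rw [h2, hyx hs, hvw hs]
      linarith [H s hs]
  rw [duhamel_noise A a β γ x₀ t hv, noiseResponse_congr hat hvw, hyx (right_mem_Icc.2 hat)] at h1
  linarith

end Pathwise

/-! ### Measurability of processes with continuous paths, by discretizing time. -/

section Measurability

theorem abs_floor_div_sub_le (s : ℝ) (n : ℕ) :
    |(⌊s * (n + 1)⌋ : ℝ) / (n + 1) - s| ≤ 1 / ((n : ℝ) + 1) := by
  have hn : (0 : ℝ) < n + 1 := by positivity
  have h : (⌊s * (n + 1)⌋ : ℝ) / (n + 1) - s = -(Int.fract (s * (n + 1)) / (n + 1)) := by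
    rw [Int.fract]
    field_simp
    ring
  rw [h, abs_neg, abs_of_nonneg (div_nonneg (Int.fract_nonneg _) hn.le)]
  gcongr
  exact (Int.fract_lt_one _).le

theorem tendsto_floor_div (s : ℝ) :
    Tendsto (fun n : ℕ ↦ (⌊s * (n + 1)⌋ : ℝ) / (n + 1)) atTop (𝓝 s) :=
  tendsto_iff_norm_sub_tendsto_zero.2 (squeeze_zero (fun _ ↦ norm_nonneg _)
    (abs_floor_div_sub_le s) tendsto_one_div_add_atTop_nhds_zero_nat)

/-- The sampled time takes countably many values, so measurability of each `X s` suffices. -/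
theorem measurable_floor_process {Ω : Type*} (m : MeasurableSpace Ω) {X : ℝ → Ω → ℝ}
    (hX : ∀ s, Measurable (X s)) (n : ℕ) :
    Measurable fun p : Ω × ℝ ↦ X ((⌊p.2 * (n + 1)⌋ : ℝ) / (n + 1)) p.1 := by
  have h : Measurable fun p : Ω × ℤ ↦ X ((p.2 : ℝ) / (n + 1)) p.1 :=
    measurable_from_prod_countable_left fun k ↦ hX ((k : ℝ) / (n + 1))
  have h' : Measurable fun p : Ω × ℝ ↦ (p.1, ⌊p.2 * (n + 1)⌋) :=
    measurable_fst.prodMk (Int.measurable_floor.comp (by fun_prop))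
  exact h.comp h'

variable {Ω : Type*} [mΩ : MeasurableSpace Ω] {P : Measure Ω}

/-- A process with almost surely continuous paths is jointly measurable, up to a null set. -/
theorem aestronglyMeasurable_uncurry_of_continuous_paths {S : Type*} [MeasurableSpace S]
    [SFinite P] {ν : Measure S} [SFinite ν] {X : ℝ → Ω → ℝ} (hX : ∀ s, Measurable (X s))
    (hc : ∀ᵐ ω ∂P, Continuous fun s ↦ X s ω) {g : S → ℝ} (hg : Measurable g) :
    AEStronglyMeasurable (fun p : Ω × S ↦ X (g p.2) p.1) (P.prod ν) := by
  refine aestronglyMeasurable_of_tendsto_ae atTop (fun n ↦ ((measurable_floor_process mΩ hX n).comp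
    (measurable_fst.prodMk (hg.comp measurable_snd))).aestronglyMeasurable) ?_
  filter_upwards [Measure.quasiMeasurePreserving_fst.ae hc] with p hp
  exact (hp.tendsto (g p.2)).comp (tendsto_floor_div (g p.2))

/-- The time integral of a process with almost surely continuous paths is measurable with respect
to any σ-algebra for which the values of the process are. -/
theorem aestronglyMeasurable_intervalIntegral (m : MeasurableSpace Ω) {X : ℝ → Ω → ℝ}
    (hX : ∀ s, Measurable[m] (X s)) (hc : ∀ᵐ ω ∂P, Continuous fun s ↦ X s ω) (a b : ℝ) :
    AEStronglyMeasurable[m] (fun ω ↦ ∫ s in a..b, X s ω) P := by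
  set J : ℕ → Ω → ℝ := fun n ω ↦ ∫ s in a..b, X ((⌊s * (n + 1)⌋ : ℝ) / (n + 1)) ω
  have hJ : ∀ n, Measurable[m] (J n) := fun n ↦ by
    have h := (measurable_floor_process m hX n).stronglyMeasurable
    simp only [J, intervalIntegral]
    exact (h.integral_prod_right' (ν := volume.restrict (Ioc a b))).measurable.sub
      (h.integral_prod_right' (ν := volume.restrict (Ioc b a))).measurable
  -- The `limsup` is `m`-measurable everywhere, whereas the exceptional null set of discontinuous
  -- paths need not belong to `m`.
  refine ⟨fun ω ↦ limsup (fun n ↦ J n ω) atTop, (Measurable.limsup hJ).stronglyMeasurable, ?_⟩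
  filter_upwards [hc] with ω hω
  refine (Tendsto.limsup_eq ?_).symm
  -- The margin `1` contains all sampling times, which differ from `s` by at most `1 / (n + 1)`.
  obtain ⟨K, hK⟩ := (isCompact_Icc (a := min a b - 1) (b := max a b + 1)).exists_bound_of_continuousOn
    hω.continuousOn
  refine intervalIntegral.tendsto_integral_filter_of_dominated_convergence (fun _ ↦ K)
    (.of_forall fun n ↦ ?_) (.of_forall fun n ↦ .of_forall fun s hs ↦ ?_) (by simp)
    (.of_forall fun s _ ↦ (hω.tendsto s).comp (tendsto_floor_div s))
  · exact ((hω.measurable.comp ((measurable_from_top (f := fun k : ℤ ↦ (k : ℝ) / (n + 1))).comp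
      (Int.measurable_floor.comp (measurable_id.mul_const _))))).aestronglyMeasurable
  · refine hK _ ?_
    have h1 := abs_le.1 (abs_floor_div_sub_le s n)
    have h2 : 1 / ((n : ℝ) + 1) ≤ 1 := by
      rw [div_le_one (by positivity)]; linarith [n.cast_nonneg (α := ℝ)]
    rw [uIoc, mem_Ioc] at hs
    constructor <;> linarith

end Measurability

/-! ### Paths and covariance of the scalar Wiener process. -/

section Wiener

variable {Ω : Type*} [MeasurableSpace Ω] {P : Measure Ω} {t₀ : ℝ} {W : ℝ → Ω → ℝ}

/-- The increments of a scalar Wiener process form a real Brownian motion. -/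
theorem IsWiener.isBrownianReal (hW : IsWiener P t₀ W) :
    IsBrownianReal (fun (s : ℝ≥0) ω ↦ W (t₀ + s) ω - W t₀ ω) P := by
  have h := hW.brownian ⟨0, by simp⟩
  set e : ℝ := stdOrthonormalBasis ℝ ℝ ⟨0, by simp⟩
  have he : |e| = 1 := (stdOrthonormalBasis ℝ ℝ).norm_eq_one _
  -- A unit vector of the line is `1` or `-1`, and Brownian motion is symmetric under negation.
  rcases (abs_eq zero_le_one).1 he with h1 | h1
  · simpa [h1] using h
  · have h' := h.neg
    simp only [h1] at h'
    convert h' using 3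
    simp

theorem IsWiener.continuous_clamp (hW : IsWiener P t₀ W) :
    ∀ᵐ ω ∂P, Continuous fun s ↦ W (max t₀ s) ω - W t₀ ω := by
  filter_upwards [hW.isBrownianReal.cont] with ω hω
  have h : (fun s ↦ W (max t₀ s) ω - W t₀ ω) =
      (fun s : ℝ≥0 ↦ W (t₀ + s) ω - W t₀ ω) ∘ fun s ↦ Real.toNNReal (s - t₀) := by
    ext s
    simp only [Function.comp_apply, Real.coe_toNNReal', ← max_add_add_left]
    simp [max_comm]
  rw [h]
  exact hω.comp (by fun_prop)

theorem IsWiener.continuousOn (hW : IsWiener P t₀ W) (t : ℝ) :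
    ∀ᵐ ω ∂P, ContinuousOn (fun s ↦ W s ω - W t₀ ω) (Icc t₀ t) := by
  filter_upwards [hW.continuous_clamp] with ω hω
  refine hω.continuousOn.congr fun s hs ↦ ?_
  simp only [max_eq_right hs.1]

theorem exists_nnreal_add_eq {a s : ℝ} (hs : a ≤ s) : ∃ u : ℝ≥0, a + u = s :=
  ⟨Real.toNNReal (s - a), by rw [Real.coe_toNNReal _ (sub_nonneg.2 hs)]; ring⟩

theorem IsWiener.memLp_two (hW : IsWiener P t₀ W) {s : ℝ} (hs : t₀ ≤ s) :
    MemLp (fun ω ↦ W s ω - W t₀ ω) 2 P := by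
  obtain ⟨u, rfl⟩ := exists_nnreal_add_eq hs
  exact (hW.isBrownianReal.isGaussianProcess.hasGaussianLaw_eval u).memLp_two

theorem IsWiener.integral_increment (hW : IsWiener P t₀ W) {s : ℝ} (hs : t₀ ≤ s) :
    ∫ ω, (W s ω - W t₀ ω) ∂P = 0 := by
  obtain ⟨u, rfl⟩ := exists_nnreal_add_eq hs
  exact hW.isBrownianReal.integral_eval u

theorem IsWiener.integral_increment_mul [IsProbabilityMeasure P] (hW : IsWiener P t₀ W) {s r : ℝ}
    (hs : t₀ ≤ s) (hr : t₀ ≤ r) :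
    ∫ ω, (W s ω - W t₀ ω) * (W r ω - W t₀ ω) ∂P = min s r - t₀ := by
  obtain ⟨u, rfl⟩ := exists_nnreal_add_eq hs
  obtain ⟨v, rfl⟩ := exists_nnreal_add_eq hr
  have h := hW.isBrownianReal.covariance_fun_eval u v
  rw [covariance_eq_sub (hW.memLp_two hs) (hW.memLp_two hr), hW.integral_increment hs, zero_mul,
    sub_zero] at h
  rw [min_add_add_left, add_sub_cancel_left, ← NNReal.coe_min]
  exact h

end Wiener

/-! ### Itô integrals of constants. -/

section Ito

variable {Ω : Type*} [MeasurableSpace Ω] {P : Measure Ω}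

theorem tendstoInMeasure_of_forall_eq {f : ℕ → Ω → ℝ} {g : Ω → ℝ} (h : ∀ k, f k = g) :
    TendstoInMeasure P f atTop g := by
  intro ε hε
  simp [h, hε.ne']

/-- The Itô integral of a constant is a multiple of the increment of the noise. -/
theorem isItoIntegral_const_iff {W : ℝ → Ω → ℝ} {a t : ℝ} (hat : a ≤ t) (γ : ℝ) {I : Ω → ℝ} :
    IsItoIntegral P W (fun _ _ ↦ γ • ContinuousLinearMap.id ℝ ℝ) a t I ↔
      I =ᵐ[P] fun ω ↦ γ * (W t ω - W a ω) := by
  have hsum : ∀ (n : ℕ) (p : ℕ → ℝ) (ω : Ω), p 0 = a → p n = t →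
      ∑ i ∈ Finset.range n, (γ • ContinuousLinearMap.id ℝ ℝ) (W (p (i + 1)) ω - W (p i) ω) =
        γ * (W t ω - W a ω) := fun n p ω h0 hn ↦ by
    simp only [smul_apply, ContinuousLinearMap.id_apply, smul_eq_mul]
    rw [← Finset.mul_sum, Finset.sum_range_sub (fun i ↦ W (p i) ω), h0, hn]
  constructor
  · intro h
    -- One admissible sequence of partitions is enough, as limits in measure are almost everywhere
    -- unique. The uniform one with `k + 1` steps is taken, stopped at `t`.
    have h' := h (fun k ↦ k + 1) (fun k i ↦ a + (t - a) * min ((i : ℝ) / (k + 1)) 1) ?_ ?_ ?_ ?_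
    · exact tendstoInMeasure_ae_unique h' (tendstoInMeasure_of_forall_eq fun k ↦ funext fun ω ↦
        hsum (k + 1) (fun i ↦ a + (t - a) * min ((i : ℝ) / (k + 1)) 1) ω (by simp) (by
          push_cast
          rw [div_self (by positivity), min_self]
          ring))
    · intro k i j hij
      have := sub_nonneg.2 hat
      simp only
      gcongr
    · simp
    · intro k
      push_cast
      rw [div_self (by positivity), min_self]
      ring
    · intro δ hδ
      have hlim : Tendsto (fun k : ℕ ↦ (t - a) * (1 / ((k : ℝ) + 1))) atTop (𝓝 0) := by
        simpa using tendsto_one_div_add_atTop_nhds_zero_nat.const_mul (t - a)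
      filter_upwards [hlim.eventually_lt_const hδ] with k hk i hi
      refine lt_of_le_of_lt ?_ hk
      have h1 : min (((i + 1 : ℕ) : ℝ) / (k + 1)) 1 ≤ min ((i : ℝ) / (k + 1)) 1 + 1 / (k + 1) := by
        have : (0 : ℝ) ≤ 1 / (k + 1) := by positivity
        rw [← min_add_add_right]
        push_cast
        rw [add_div]
        exact min_le_min_left _ (by linarith)
      have := mul_le_mul_of_nonneg_left h1 (sub_nonneg.2 hat)
      linarith
  · intro h N p _ h0 hN _
    exact (tendstoInMeasure_of_forall_eq fun k ↦ funext fun ω ↦ hsum (N k) (p k) ω (h0 k)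
      (hN k)).congr_right h.symm

end Ito

/-! ### The deterministic integrals behind the Itô isometry. -/

section KernelIntegrals

/-- Integration by parts in `r`: `min s r - a` has slope `1` on `[a, s]` and slope `0` on `[s, t]`,
and the boundary term at `r = t` is `-(s - a)`. -/
theorem mul_integral_exp_mul_min {A a s t : ℝ} (hs : s ∈ Icc a t) :
    A * ∫ r in a..t, Real.exp (A * (t - r)) * (min s r - a) =
      (∫ r in a..s, Real.exp (A * (t - r))) - (s - a) := by
  have hint : ∀ u v, IntervalIntegrable (fun r ↦ Real.exp (A * (t - r)) * (min s r - a)) volume u v :=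
    fun u v ↦ Continuous.intervalIntegrable (by fun_prop) _ _
  rw [← intervalIntegral.integral_add_adjacent_intervals (hint a s) (hint s t)]
  have h1 : ∫ r in a..s, Real.exp (A * (t - r)) * (min s r - a) =
      ∫ r in a..s, Real.exp (A * (t - r)) * (r - a) := by
    refine intervalIntegral.integral_congr fun r hr ↦ ?_
    rw [uIcc_of_le hs.1] at hr
    simp only [min_eq_right hr.2]
  have h2 : ∫ r in s..t, Real.exp (A * (t - r)) * (min s r - a) =
      ∫ r in s..t, Real.exp (A * (t - r)) * (s - a) := by
    refine intervalIntegral.integral_congr fun r hr ↦ ?_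
    rw [uIcc_of_le hs.2] at hr
    simp only [min_eq_left hr.1]
  have h3 : ∫ r in a..s, (Real.exp (A * (t - r)) - A * (Real.exp (A * (t - r)) * (r - a))) =
      Real.exp (A * (t - s)) * (s - a) := by
    rw [intervalIntegral.integral_eq_sub_of_hasDerivAt
      (f := fun r ↦ Real.exp (A * (t - r)) * (r - a)) (fun r _ ↦ ?_)
      (Continuous.intervalIntegrable (by fun_prop) _ _)]
    · simp
    · refine ((hasDerivAt_exp_mul_sub_left A t r).mul ((hasDerivAt_id r).sub_const a)).congr_deriv ?_
      simp only [id]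
      ring
  rw [intervalIntegral.integral_sub (Continuous.intervalIntegrable (by fun_prop) _ _)
    (Continuous.intervalIntegrable (by fun_prop) _ _), intervalIntegral.integral_const_mul] at h3
  have h4 : ∫ r in s..t, A * Real.exp (A * (t - r)) = Real.exp (A * (t - s)) - 1 := by
    rw [intervalIntegral.integral_eq_sub_of_hasDerivAt
      (f := fun r ↦ -Real.exp (A * (t - r))) (fun r _ ↦ ?_)
      (Continuous.intervalIntegrable (by fun_prop) _ _)]
    · simp
      ring
    · exact (hasDerivAt_exp_mul_sub_left A t r).neg.congr_deriv (by ring)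
  rw [intervalIntegral.integral_const_mul] at h4
  rw [h1, h2, intervalIntegral.integral_mul_const]
  linear_combination -h3 + (s - a) * h4

/-- Integrate the derivative of `e^{A(t-s)} G s`, which is `e^{2A(t-s)} - A e^{A(t-s)} G s`. -/
theorem mul_integral_exp_mul_integral_exp (A a t : ℝ) :
    A * ∫ s in a..t, Real.exp (A * (t - s)) * ∫ r in a..s, Real.exp (A * (t - r)) =
      (∫ s in a..t, Real.exp (2 * A * (t - s))) - ∫ s in a..t, Real.exp (A * (t - s)) := by
  set G : ℝ → ℝ := fun s ↦ ∫ r in a..s, Real.exp (A * (t - r))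
  have hG : ∀ s, HasDerivAt G (Real.exp (A * (t - s))) s :=
    fun s ↦ hasDerivAt_integral_right (f := fun r ↦ Real.exp (A * (t - r))) (by fun_prop) a s
  have hGc : Continuous G := continuous_iff_continuousAt.2 fun s ↦ (hG s).continuousAt
  have h : ∫ s in a..t, (Real.exp (2 * A * (t - s)) - A * (Real.exp (A * (t - s)) * G s)) =
      G t := by
    rw [intervalIntegral.integral_eq_sub_of_hasDerivAt
      (f := fun s ↦ Real.exp (A * (t - s)) * G s) (fun s _ ↦ ?_)
      (Continuous.intervalIntegrable (by fun_prop) _ _)]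
    · simp [G]
    · refine ((hasDerivAt_exp_mul_sub_left A t s).mul (hG s)).congr_deriv ?_
      rw [mul_assoc 2 A, two_mul, Real.exp_add]
      ring
  rw [intervalIntegral.integral_sub (Continuous.intervalIntegrable (by fun_prop) _ _)
    (Continuous.intervalIntegrable (by fun_prop) _ _), intervalIntegral.integral_const_mul] at h
  change A * ∫ s in a..t, Real.exp (A * (t - s)) * G s = _ - G t
  linarith

/-- The left side is the expansion of `𝔼 (w_t + A ∫ e^{A(t-s)} w_s ds)²` under the covariance `min s
r - a`. -/
theorem noiseResponse_variance_eq {A a t : ℝ} (hat : a ≤ t) :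
    (t - a) + 2 * A * (∫ s in a..t, Real.exp (A * (t - s)) * (s - a)) +
      A ^ 2 * (∫ s in a..t, ∫ r in a..t,
        Real.exp (A * (t - s)) * Real.exp (A * (t - r)) * (min s r - a)) =
      ∫ s in a..t, Real.exp (2 * A * (t - s)) := by
  have h1 := mul_integral_exp_mul_min (A := A) (right_mem_Icc.2 hat)
  have h1' : ∫ r in a..t, Real.exp (A * (t - r)) * (min t r - a) =
      ∫ r in a..t, Real.exp (A * (t - r)) * (r - a) := by
    refine intervalIntegral.integral_congr fun r hr ↦ ?_
    rw [uIcc_of_le hat] at hr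
    simp only [min_eq_right hr.2]
  rw [h1'] at h1
  have h2 := mul_integral_exp_mul_integral_exp A a t
  have hGc : Continuous fun s ↦ ∫ r in a..s, Real.exp (A * (t - r)) :=
    continuous_iff_continuousAt.2 fun s ↦ (hasDerivAt_integral_right
      (f := fun r ↦ Real.exp (A * (t - r))) (by fun_prop) a s).continuousAt
  have h3 : A * ∫ s in a..t, ∫ r in a..t,
      Real.exp (A * (t - s)) * Real.exp (A * (t - r)) * (min s r - a) =
      (∫ s in a..t, Real.exp (A * (t - s)) * ∫ r in a..s, Real.exp (A * (t - r))) -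
        ∫ s in a..t, Real.exp (A * (t - s)) * (s - a) := by
    rw [← intervalIntegral.integral_sub (Continuous.intervalIntegrable (by fun_prop) _ _)
      (Continuous.intervalIntegrable (by fun_prop) _ _), ← intervalIntegral.integral_const_mul]
    refine intervalIntegral.integral_congr fun s hs ↦ ?_
    rw [uIcc_of_le hat] at hs
    simp only [mul_assoc, intervalIntegral.integral_const_mul]
    linear_combination Real.exp (A * (t - s)) * mul_integral_exp_mul_min (A := A) hs
  linear_combination h1 + h2 + A * h3

end KernelIntegrals

/-! ### Mean and variance of the noise response, by Fubini. -/

section Moments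

variable {Ω : Type*} [MeasurableSpace Ω] {P : Measure Ω}

theorem integrable_prod_of_integral_abs_le {S : Type*} [MeasurableSpace S] [SFinite P]
    {ν : Measure S} [IsFiniteMeasure ν] {F : Ω → S → ℝ}
    (hF : AEStronglyMeasurable (Function.uncurry F) (P.prod ν)) (K : ℝ)
    (hi : ∀ᵐ s ∂ν, Integrable (fun ω ↦ F ω s) P) (hK : ∀ᵐ s ∂ν, ∫ ω, |F ω s| ∂P ≤ K) :
    Integrable (Function.uncurry F) (P.prod ν) := by
  rw [integrable_prod_iff' hF]
  refine ⟨hi, Integrable.of_bound (C := K) ?_ ?_⟩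
  · exact hF.norm.prod_swap.integral_prod_right'
  · filter_upwards [hK] with s hs
    rw [Real.norm_eq_abs, abs_of_nonneg (by positivity)]
    exact hs

variable {t₀ : ℝ} {W : ℝ → Ω → ℝ}

theorem IsWiener.integral_abs_increment_mul_le [IsProbabilityMeasure P] (hW : IsWiener P t₀ W)
    {s r t : ℝ} (hs : s ∈ Icc t₀ t) (hr : r ∈ Icc t₀ t) :
    ∫ ω, |(W s ω - W t₀ ω) * (W r ω - W t₀ ω)| ∂P ≤ t - t₀ := by
  have h1 := (hW.memLp_two hs.1).integrable_sq
  have h2 := (hW.memLp_two hr.1).integrable_sq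
  have h3 : ∀ ω, |(W s ω - W t₀ ω) * (W r ω - W t₀ ω)| ≤
      2⁻¹ * (W s ω - W t₀ ω) ^ 2 + 2⁻¹ * (W r ω - W t₀ ω) ^ 2 := fun ω ↦ by
    rw [abs_mul, ← sq_abs (W s ω - W t₀ ω), ← sq_abs (W r ω - W t₀ ω)]
    linarith [two_mul_le_add_sq |W s ω - W t₀ ω| |W r ω - W t₀ ω|]
  have h4 := hW.integral_increment_mul hs.1 hs.1
  have h5 := hW.integral_increment_mul hr.1 hr.1
  simp only [← sq, min_self] at h4 h5
  calc _ ≤ ∫ ω, (2⁻¹ * (W s ω - W t₀ ω) ^ 2 + 2⁻¹ * (W r ω - W t₀ ω) ^ 2) ∂P :=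
        integral_mono ((hW.memLp_two hs.1).integrable_mul (hW.memLp_two hr.1)).abs
          ((h1.const_mul _).add (h2.const_mul _)) h3
    _ = 2⁻¹ * (s - t₀) + 2⁻¹ * (r - t₀) := by
        rw [integral_add (h1.const_mul _) (h2.const_mul _), integral_const_mul, integral_const_mul,
          h4, h5]
    _ ≤ t - t₀ := by linarith [hs.2, hr.2]

/-- Measurability and path continuity are known only from `t₀` on, so time is clamped at `t₀`, which
changes nothing `ν`-almost everywhere. -/
theorem IsWiener.aestronglyMeasurable_uncurry [SFinite P] (hW : IsWiener P t₀ W)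
    {S : Type*} [MeasurableSpace S] {ν : Measure S} [SFinite ν] {g : S → ℝ} (hg : Measurable g)
    (hg' : ∀ᵐ y ∂ν, t₀ ≤ g y) :
    AEStronglyMeasurable (fun p : Ω × S ↦ W (g p.2) p.1 - W t₀ p.1) (P.prod ν) := by
  have h := aestronglyMeasurable_uncurry_of_continuous_paths (ν := ν)
    (X := fun s ω ↦ W (max t₀ s) ω - W t₀ ω)
    (fun s ↦ (hW.measurable _ (le_max_left _ _)).sub (hW.measurable _ le_rfl))
    hW.continuous_clamp hg
  refine h.congr ?_
  filter_upwards [Measure.quasiMeasurePreserving_snd.ae hg'] with p hp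
  rw [max_eq_right hp]

theorem IsWiener.integral_abs_increment_le [IsProbabilityMeasure P] (hW : IsWiener P t₀ W)
    {s t : ℝ} (hs : s ∈ Icc t₀ t) :
    ∫ ω, |W s ω - W t₀ ω| ∂P ≤ 1 + (t - t₀) := by
  have h1 := (hW.memLp_two hs.1).integrable_sq
  have h2 := hW.integral_increment_mul hs.1 hs.1
  simp only [← sq, min_self] at h2
  calc _ ≤ ∫ ω, (1 + (W s ω - W t₀ ω) ^ 2) ∂P := by
        refine integral_mono ((hW.memLp_two hs.1).integrable one_le_two).abs
          ((integrable_const _).add h1) fun ω ↦ ?_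
        simp only
        nlinarith [sq_abs (W s ω - W t₀ ω), sq_nonneg (|W s ω - W t₀ ω| - 1)]
    _ = 1 + (s - t₀) := by
        rw [integral_add (integrable_const _) h1, h2]
        simp
    _ ≤ 1 + (t - t₀) := by linarith [hs.2]

/-- Fubini's theorem for weighted products of two increments of the noise. -/
theorem IsWiener.integrable_mul_prod [IsProbabilityMeasure P] (hW : IsWiener P t₀ W) {t : ℝ}
    {S : Type*} [MeasurableSpace S] {ν : Measure S} [IsFiniteMeasure ν] {φ g h : S → ℝ}
    (hφ : Measurable φ) (hg : Measurable g) (hh : Measurable h) (M : ℝ)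
    (hM : ∀ᵐ y ∂ν, |φ y| ≤ M ∧ g y ∈ Icc t₀ t ∧ h y ∈ Icc t₀ t) :
    Integrable (Function.uncurry fun ω y ↦
      φ y * ((W (g y) ω - W t₀ ω) * (W (h y) ω - W t₀ ω))) (P.prod ν) := by
  refine integrable_prod_of_integral_abs_le ?_ (M * (t - t₀)) ?_ ?_
  · exact (hφ.comp measurable_snd).aestronglyMeasurable.mul
      ((hW.aestronglyMeasurable_uncurry hg (hM.mono fun _ h ↦ h.2.1.1)).mul
        (hW.aestronglyMeasurable_uncurry hh (hM.mono fun _ h ↦ h.2.2.1)))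
  · filter_upwards [hM] with y hy
    exact ((hW.memLp_two hy.2.1.1).integrable_mul (hW.memLp_two hy.2.2.1)).const_mul _
  · filter_upwards [hM] with y hy
    simp only [abs_mul (φ y)]
    rw [integral_const_mul]
    exact mul_le_mul hy.1 (hW.integral_abs_increment_mul_le hy.2.1 hy.2.2)
      (integral_nonneg fun _ ↦ abs_nonneg _) ((abs_nonneg _).trans hy.1)

theorem abs_exp_mul_sub_le {A t₀ t s : ℝ} (hs : s ∈ Icc t₀ t) :
    |Real.exp (A * (t - s))| ≤ Real.exp (|A| * (t - t₀)) := by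
  rw [abs_of_pos (Real.exp_pos _), Real.exp_le_exp]
  exact mul_le_mul (le_abs_self A) (by linarith [hs.1]) (by linarith [hs.2]) (abs_nonneg A)

/-- The noise response is centred with variance `∫_{t₀}^t e^{2A(t-s)} ds` (**Itô isometry**). -/
theorem IsWiener.noiseResponse_moments [IsProbabilityMeasure P] (hW : IsWiener P t₀ W) (A : ℝ)
    {t : ℝ} (ht : t₀ ≤ t) :
    MemLp (fun ω ↦ noiseResponse A t₀ (fun s ↦ W s ω - W t₀ ω) t) 2 P ∧
    ∫ ω, noiseResponse A t₀ (fun s ↦ W s ω - W t₀ ω) t ∂P = 0 ∧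
    ∫ ω, noiseResponse A t₀ (fun s ↦ W s ω - W t₀ ω) t ^ 2 ∂P =
      ∫ s in t₀..t, Real.exp (2 * A * (t - s)) := by
  set ν : Measure ℝ := volume.restrict (Ioc t₀ t)
  set w : ℝ → Ω → ℝ := fun s ω ↦ W s ω - W t₀ ω
  set V : Ω → ℝ := fun ω ↦ ∫ s, Real.exp (A * (t - s)) * w s ω ∂ν
  have hV : ∀ ω, noiseResponse A t₀ (fun s ↦ W s ω - W t₀ ω) t = w t ω + A * V ω := fun ω ↦ by
    rw [noiseResponse, intervalIntegral.integral_of_le ht]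
  simp only [hV]
  have hν : ∀ᵐ s ∂ν, s ∈ Icc t₀ t :=
    (ae_restrict_mem measurableSet_Ioc).mono fun s hs ↦ Ioc_subset_Icc_self hs
  have htt : t ∈ Icc t₀ t := right_mem_Icc.2 ht
  have hwt := hW.memLp_two ht
  -- the square of the time integral
  set F : Ω → ℝ × ℝ → ℝ := fun ω y ↦
    Real.exp (A * (t - y.1)) * Real.exp (A * (t - y.2)) * (w y.1 ω * w y.2 ω)
  have hF : Integrable (Function.uncurry F) (P.prod (ν.prod ν)) := by
    refine hW.integrable_mul_prod (t := t) (by fun_prop) measurable_fst measurable_snd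
      (Real.exp (|A| * (t - t₀)) * Real.exp (|A| * (t - t₀))) ?_
    filter_upwards [Measure.quasiMeasurePreserving_fst.ae hν,
      Measure.quasiMeasurePreserving_snd.ae hν] with y h1 h2
    refine ⟨?_, h1, h2⟩
    rw [abs_mul]
    exact mul_le_mul (abs_exp_mul_sub_le h1) (abs_exp_mul_sub_le h2) (abs_nonneg _)
      (Real.exp_pos _).le
  have hVF : ∀ ω, V ω ^ 2 = ∫ y, F ω y ∂(ν.prod ν) := fun ω ↦ by
    rw [sq, ← integral_prod_mul]
    congr 1 with y
    ring
  have hV2 : Integrable (fun ω ↦ V ω ^ 2) P := by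
    simp only [hVF]
    exact hF.integral_prod_left
  have hFcov : ∀ᵐ y ∂(ν.prod ν), ∫ ω, F ω y ∂P =
      Real.exp (A * (t - y.1)) * Real.exp (A * (t - y.2)) * (min y.1 y.2 - t₀) := by
    filter_upwards [Measure.quasiMeasurePreserving_fst.ae hν,
      Measure.quasiMeasurePreserving_snd.ae hν] with y h1 h2
    rw [integral_const_mul, hW.integral_increment_mul h1.1 h2.1]
  have hEV2 : ∫ ω, V ω ^ 2 ∂P = ∫ s in t₀..t, ∫ r in t₀..t,
      Real.exp (A * (t - s)) * Real.exp (A * (t - r)) * (min s r - t₀) := by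
    simp only [hVF]
    rw [integral_integral_swap hF, integral_congr_ae hFcov,
      integral_prod _ (hF.integral_prod_right.congr hFcov)]
    simp only [intervalIntegral.integral_of_le ht]
    rfl
  -- the covariance of the time integral with the terminal value
  set H : Ω → ℝ → ℝ := fun ω s ↦ Real.exp (A * (t - s)) * (w t ω * w s ω)
  have hH : Integrable (Function.uncurry H) (P.prod ν) :=
    hW.integrable_mul_prod (t := t) (by fun_prop) measurable_const measurable_id
      (Real.exp (|A| * (t - t₀))) (hν.mono fun s hs ↦ ⟨abs_exp_mul_sub_le hs, htt, hs⟩)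
  have hVH : ∀ ω, w t ω * V ω = ∫ s, H ω s ∂ν := fun ω ↦ by
    rw [← integral_const_mul]
    congr 1 with s
    ring
  have hwV : Integrable (fun ω ↦ w t ω * V ω) P := by
    simp only [hVH]
    exact hH.integral_prod_left
  have hEwV : ∫ ω, w t ω * V ω ∂P = ∫ s in t₀..t, Real.exp (A * (t - s)) * (s - t₀) := by
    simp only [hVH]
    rw [integral_integral_swap hH, intervalIntegral.integral_of_le ht]
    refine integral_congr_ae ?_
    filter_upwards [hν] with s hs
    rw [integral_const_mul, hW.integral_increment_mul ht hs.1, min_eq_right hs.2]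
  -- the mean of the time integral
  have hL : Integrable (Function.uncurry fun ω s ↦ Real.exp (A * (t - s)) * w s ω) (P.prod ν) := by
    refine integrable_prod_of_integral_abs_le ?_
      (Real.exp (|A| * (t - t₀)) * (1 + (t - t₀))) ?_ ?_
    · exact (Measurable.aestronglyMeasurable (by fun_prop)).mul
        (hW.aestronglyMeasurable_uncurry measurable_id (hν.mono fun s hs ↦ hs.1))
    · filter_upwards [hν] with s hs
      exact ((hW.memLp_two hs.1).integrable one_le_two).const_mul _
    · filter_upwards [hν] with s hs
      simp only [abs_mul (Real.exp _)]
      rw [integral_const_mul]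
      exact mul_le_mul (abs_exp_mul_sub_le hs) (hW.integral_abs_increment_le hs)
        (integral_nonneg fun _ ↦ abs_nonneg _) (Real.exp_pos _).le
  have hVi : Integrable V P := hL.integral_prod_left
  have hEV : ∫ ω, V ω ∂P = 0 := by
    rw [integral_integral_swap hL]
    refine integral_eq_zero_of_ae ?_
    filter_upwards [hν] with s hs
    rw [integral_const_mul, hW.integral_increment hs.1, mul_zero, Pi.zero_apply]
  have hVL : MemLp V 2 P := (memLp_two_iff_integrable_sq hVi.aestronglyMeasurable).2 hV2
  refine ⟨hwt.add (hVL.const_mul A), ?_, ?_⟩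
  · rw [integral_add (hwt.integrable one_le_two) (hVi.const_mul A), integral_const_mul,
      hW.integral_increment ht, hEV, mul_zero, add_zero]
  · have hsq : ∀ ω, (w t ω + A * V ω) ^ 2 =
        w t ω * w t ω + 2 * A * (w t ω * V ω) + A ^ 2 * V ω ^ 2 := fun ω ↦ by ring
    have hww : Integrable (fun ω ↦ w t ω * w t ω) P := hwt.integrable_mul hwt
    have hww' : Integrable (fun ω ↦ w t ω * w t ω + 2 * A * (w t ω * V ω)) P :=
      hww.add (hwV.const_mul _)
    simp only [hsq]
    rw [integral_add hww' (hV2.const_mul _), integral_add hww (hwV.const_mul _),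
      integral_const_mul, integral_const_mul,
      hW.integral_increment_mul ht ht, hEwV, hEV2, min_self, noiseResponse_variance_eq ht]

end Moments

/-! ### Solutions of the scalar linear equation, their mean squares, and optimality. -/

section LinearSDE

theorem measurable_noiseSigmaAlgebra {Ω : Type*} {W : ℝ → Ω → ℝ} {t₀ s t : ℝ} (hs : s ∈ Icc t₀ t) :
    Measurable[noiseSigmaAlgebra W t₀ t] fun ω ↦ W s ω - W t₀ ω :=
  Measurable.mono (comap_measurable _) (le_iSup₂_of_le s hs le_rfl) le_rfl

variable {Ω : Type*} [MeasurableSpace Ω] {P : Measure Ω} {t₀ t₁ : ℝ} {W : ℝ → Ω → ℝ}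

/-- The scalar linear equation `dx = (A x + β) dt + γ dW` is solvable. -/
theorem IsWiener.isSDESolution_linear (hW : IsWiener P t₀ W) (A β γ x₀ : ℝ) :
    IsSDESolution P W t₀ t₁ (fun y _ ↦ A * y + β) (fun _ _ ↦ γ • ContinuousLinearMap.id ℝ ℝ) x₀
      (fun t ω ↦ Real.exp (A * (t - t₀)) * x₀ + β * (∫ s in t₀..t, Real.exp (A * (t - s))) +
        γ * noiseResponse A t₀ (fun s ↦ W s ω - W t₀ ω) t) where
  adapted t ht := by
    -- Clamping `s` to `[t₀, t]` makes the integrand measurable for the noise up to time `t` at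
    -- every real `s`, without altering the integral.
    have hX : AEStronglyMeasurable[noiseSigmaAlgebra W t₀ t]
        (fun ω ↦ ∫ s in t₀..t, Real.exp (A * (t - s)) * (W (max t₀ (min s t)) ω - W t₀ ω)) P := by
      refine aestronglyMeasurable_intervalIntegral _ (fun s ↦ ?_) ?_ _ _
      · exact (measurable_noiseSigmaAlgebra
          ⟨le_max_left _ _, max_le ht.1 (min_le_right _ _)⟩).const_mul _
      · filter_upwards [hW.continuous_clamp] with ω hω
        have h : Continuous fun s ↦ W (max t₀ (min s t)) ω - W t₀ ω :=
          hω.comp (by fun_prop : Continuous fun s : ℝ ↦ min s t)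
        fun_prop
    have hX' : (fun ω ↦ ∫ s in t₀..t, Real.exp (A * (t - s)) *
        (W (max t₀ (min s t)) ω - W t₀ ω)) =
        fun ω ↦ ∫ s in t₀..t, Real.exp (A * (t - s)) * (W s ω - W t₀ ω) := by
      ext ω
      refine intervalIntegral.integral_congr fun s hs ↦ ?_
      rw [uIcc_of_le ht.1] at hs
      simp only [min_eq_left hs.2, max_eq_right hs.1]
    rw [hX'] at hX
    have hw : AEStronglyMeasurable[noiseSigmaAlgebra W t₀ t] (fun ω ↦ W t ω - W t₀ ω) P :=
      (measurable_noiseSigmaAlgebra (right_mem_Icc.2 ht.1)).stronglyMeasurable.aestronglyMeasurable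
    exact aestronglyMeasurable_const.add ((hw.add (hX.const_mul A)).const_mul γ)
  continuous_paths := by
    filter_upwards [hW.continuous_clamp] with ω hω
    have hG : Continuous fun t ↦ ∫ s in t₀..t, Real.exp (A * (t - s)) := by
      simpa using continuous_integral_exp_mul_sub_mul A t₀ (continuous_const (y := (1 : ℝ)))
    have hN : ContinuousOn (fun t ↦ noiseResponse A t₀ (fun s ↦ W s ω - W t₀ ω) t) (Icc t₀ t₁) :=
      (continuous_noiseResponse A t₀ hω).continuousOn.congr fun t ht ↦
        noiseResponse_congr ht.1 fun s hs ↦ by simp only [max_eq_right hs.1]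
    fun_prop
  initial := by simp [noiseResponse]
  equation t ht := by
    rw [isItoIntegral_const_iff ht.1]
    filter_upwards [hW.continuousOn t₁] with ω hω
    exact noiseResponse_integral_eq hω ht fun s _ ↦ rfl

/-- Solutions of the scalar linear equation are given by the variation of constants formula. -/
theorem IsWiener.ae_eq_of_isSDESolution_linear (hW : IsWiener P t₀ W) {A β γ x₀ : ℝ}
    {x : ℝ → Ω → ℝ} (hx : IsSDESolution P W t₀ t₁ (fun y _ ↦ A * y + β)
      (fun _ _ ↦ γ • ContinuousLinearMap.id ℝ ℝ) x₀ x) {t : ℝ} (ht : t ∈ Icc t₀ t₁) :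
    ∀ᵐ ω ∂P, x t ω = Real.exp (A * (t - t₀)) * x₀ + β * (∫ s in t₀..t, Real.exp (A * (t - s))) +
        γ * noiseResponse A t₀ (fun s ↦ W s ω - W t₀ ω) t := by
  -- The equation holds almost surely at each fixed time. A countable dense set of times gives one
  -- common null set, and continuity of both sides extends the identity to all of `[t₀, t]`.
  obtain ⟨D, hDc, hD⟩ := TopologicalSpace.exists_countable_dense (Icc t₀ t)
  have heq : ∀ᵐ ω ∂P, ∀ s ∈ D, x s ω - x₀ - ∫ r in t₀..s, (A * x r ω + β) =
      γ * (W s ω - W t₀ ω) := by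
    rw [ae_ball_iff hDc]
    intro s _
    exact (isItoIntegral_const_iff s.2.1 γ).1 (hx.equation s ⟨s.2.1, s.2.2.trans ht.2⟩)
  filter_upwards [heq, hW.continuousOn t, hx.continuous_paths] with ω h hw hxc
  have hxc' : ContinuousOn (fun s ↦ x s ω) (Icc t₀ t) := hxc.mono (Icc_subset_Icc_right ht.2)
  refine eq_noiseResponse_of_integral_eq (x := fun s ↦ x s ω) ht.1 hw hxc' ?_
  have hint : ContinuousOn (fun s ↦ ∫ r in t₀..s, (A * x r ω + β)) (Icc t₀ t) := by
    have := intervalIntegral.continuousOn_primitive_interval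
      (f := fun r ↦ A * x r ω + β) (a := t₀) (b := t) (μ := volume) ?_
    · rwa [uIcc_of_le ht.1] at this
    · rw [uIcc_of_le ht.1]
      exact ContinuousOn.integrableOn_Icc (by fun_prop)
  have hL : Continuous fun s : Icc t₀ t ↦ x s ω - x₀ - ∫ r in t₀..(s : ℝ), (A * x r ω + β) :=
    continuousOn_iff_continuous_domRestrict.1 ((hxc'.sub continuousOn_const).sub hint)
  have hR : Continuous fun s : Icc t₀ t ↦ γ * (W s ω - W t₀ ω) :=
    continuousOn_iff_continuous_domRestrict.1 (continuousOn_const.mul hw)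
  have := Continuous.ext_on hD hL hR fun s hs ↦ h s hs
  exact fun s hs ↦ congrFun this ⟨s, hs⟩

/-- The mean-squared deviation of the solution of a scalar linear equation from its noise- and
forcing-free trajectory. -/
theorem IsWiener.integral_sq_linear [IsProbabilityMeasure P] (hW : IsWiener P t₀ W)
    {A β γ x₀ : ℝ} {x : ℝ → Ω → ℝ} (hx : IsSDESolution P W t₀ t₁ (fun y _ ↦ A * y + β)
      (fun _ _ ↦ γ • ContinuousLinearMap.id ℝ ℝ) x₀ x) {t : ℝ} (ht : t ∈ Icc t₀ t₁) :
    Integrable (fun ω ↦ |x t ω - Real.exp (A * (t - t₀)) * x₀| ^ 2) P ∧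
    ∫ ω, |x t ω - Real.exp (A * (t - t₀)) * x₀| ^ 2 ∂P =
      β ^ 2 * (∫ s in t₀..t, Real.exp (A * (t - s))) ^ 2 +
        γ ^ 2 * ∫ s in t₀..t, Real.exp (2 * A * (t - s)) := by
  obtain ⟨hZ, hZ1, hZ2⟩ := hW.noiseResponse_moments A ht.1
  set Z : Ω → ℝ := fun ω ↦ noiseResponse A t₀ (fun s ↦ W s ω - W t₀ ω) t
  change ∫ ω, Z ω ^ 2 ∂P = _ at hZ2
  set G := ∫ s in t₀..t, Real.exp (A * (t - s))
  have h : (fun ω ↦ |x t ω - Real.exp (A * (t - t₀)) * x₀| ^ 2) =ᵐ[P]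
      fun ω ↦ β ^ 2 * G ^ 2 + 2 * β * G * γ * Z ω + γ ^ 2 * Z ω ^ 2 := by
    filter_upwards [hW.ae_eq_of_isSDESolution_linear hx ht] with ω hω
    rw [sq_abs, hω]
    ring
  have h1 : Integrable (fun ω ↦ β ^ 2 * G ^ 2 + 2 * β * G * γ * Z ω) P :=
    (integrable_const _).add ((hZ.integrable one_le_two).const_mul _)
  have h2 : Integrable (fun ω ↦ γ ^ 2 * Z ω ^ 2) P := hZ.integrable_sq.const_mul _
  refine ⟨(h1.add h2).congr h.symm, ?_⟩
  rw [integral_congr_ae h, integral_add h1 h2, integral_add (integrable_const _)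
    ((hZ.integrable one_le_two).const_mul _), integral_const, probReal_univ, one_smul,
    integral_const_mul, integral_const_mul, hZ1, hZ2, mul_zero, add_zero]

theorem scalarLinear_isTrajectory_iff {A b σ ε x₀ : ℝ} {x : ℝ → Ω → ℝ} :
    (scalarLinear A b σ).IsTrajectory P W ε t₀ t₁ x₀ x ↔
      IsSDESolution P W t₀ t₁ (fun y _ ↦ A * y + ε * b)
        (fun _ _ ↦ (ε * σ) • ContinuousLinearMap.id ℝ ℝ) x₀ x := by
  simp only [System.IsTrajectory, scalarLinear, smul_smul, smul_eq_mul]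

theorem scalarLinear_isLeadingOrder_iff {A b σ x₀ : ℝ} {η : ℝ → Ω → ℝ} :
    (scalarLinear A b σ).IsLeadingOrder P W t₀ t₁ x₀ η ↔
      IsSDESolution P W t₀ t₁ (fun y _ ↦ A * y + b)
        (fun _ _ ↦ σ • ContinuousLinearMap.id ℝ ℝ) 0 η := by
  have h : ∀ z y : ℝ, fderiv ℝ (fun z ↦ A * z) z y = A * y := fun z y ↦ by
    rw [fderiv_const_mul differentiableAt_id]
    simp
  simp only [System.IsLeadingOrder, scalarLinear, h]

/-- The leading-order bound is attained by scalar linear systems. -/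
theorem scalarLinear_integral_sq_leadingOrder [IsProbabilityMeasure P] (hW : IsWiener P t₀ W)
    {A b σ x₀ : ℝ} {η : ℝ → Ω → ℝ} (hη : (scalarLinear A b σ).IsLeadingOrder P W t₀ t₁ x₀ η)
    (ε : ℝ) {t : ℝ} (ht : t ∈ Icc t₀ t₁) :
    Integrable (fun ω ↦ |η t ω| ^ 2) P ∧
    ε ^ 2 * ∫ ω, |η t ω| ^ 2 ∂P = leadingBound (scalarLinear A b σ).f₀ t₀ t x₀
      ((scalarLinear A b σ).modelUncertainty ε t₀ t x₀)
      ((scalarLinear A b σ).noiseUncertainty ε t₀ t x₀) := by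
  obtain ⟨h1, h2⟩ := hW.integral_sq_linear (scalarLinear_isLeadingOrder_iff.1 hη) ht
  simp only [mul_zero, sub_zero] at h1 h2
  refine ⟨h1, ?_⟩
  rw [scalarLinear_modelUncertainty A b σ ε ht.1, scalarLinear_noiseUncertainty A b σ ε ht.1, h2,
    leadingBound]
  simp only [scalarLinear]
  rw [stretchIntegral_linear A ht.1, traceIntegral_linear A ht.1, mul_pow, sq_abs]
  ring

/-- No universal bound is smaller than the leading-order bound at a linear idealized model. -/
theorem IsUniversalBound.leadingBound_le [IsProbabilityMeasure P] (hW : IsWiener P t₀ W)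
    (ht₀ : t₀ < t₁) {Φ : (ℝ → ℝ → ℝ) → ℝ → ℝ → ℝ → ℝ → ℝ → ℝ} (hΦ : IsUniversalBound P Φ)
    (A x₀ : ℝ) {t : ℝ} (ht : t ∈ Icc t₀ t₁) {Δ Δσ : ℝ} (hΔ : 0 ≤ Δ) (hΔσ : 0 ≤ Δσ) :
    leadingBound (fun y _ ↦ A * y) t₀ t x₀ Δ Δσ ≤ Φ (fun y _ ↦ A * y) t₀ t x₀ Δ Δσ := by
  -- With `ε = 1`, the choices `b = Δ` and `σ = √Δσ` realise exactly the prescribed sizes.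
  have hη := (scalarLinear_isLeadingOrder_iff (x₀ := x₀)).2
    (hW.isSDESolution_linear (t₁ := t₁) A Δ √Δσ 0)
  have h := hΦ _ t₀ t₁ x₀ W _ ht₀ (scalarLinear_admissible A Δ √Δσ t₀ t₁) hW hη 1 zero_le_one t ht
  simp only [Real.norm_eq_abs] at h
  rw [(scalarLinear_integral_sq_leadingOrder hW hη 1 ht).2,
    scalarLinear_modelUncertainty A _ _ _ ht.1, scalarLinear_noiseUncertainty A _ _ _ ht.1,
    abs_of_nonneg hΔ, Real.sq_sqrt hΔσ, one_pow, one_mul, one_mul] at h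
  exact h

theorem leadingBound_linear_pos (A x₀ : ℝ) {t : ℝ} (ht : t₀ < t) :
    0 < leadingBound (fun y _ ↦ A * y) t₀ t x₀ 1 0 := by
  rw [leadingBound, stretchIntegral_linear A ht.le]
  have : 0 < ∫ s in t₀..t, Real.exp (A * (t - s)) :=
    intervalIntegral.intervalIntegral_pos_of_pos (Continuous.intervalIntegrable (by fun_prop) _ _)
      (fun _ ↦ Real.exp_pos _) ht
  rw [mul_zero, add_zero]
  positivity

end LinearSDE

end ModelSensitivity

theorem mainTheorem6 {Ω : Type*} [MeasurableSpace Ω] (P : Measure Ω) [IsProbabilityMeasure P]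
    (t₀ t₁ : ℝ) (ht : t₀ < t₁) (W : ℝ → Ω → ℝ) (hW : ModelSensitivity.IsWiener P t₀ W)
    (A b σ x₀ : ℝ) (S : ModelSensitivity.System ℝ)
    (hS : S = ModelSensitivity.scalarLinear A b σ) :
    -- the system is admissible, and the SDE and its leading-order equation are solvable
    S.Admissible t₀ t₁ ∧
    (∀ ε : ℝ, 0 ≤ ε → ∃ x, S.IsTrajectory P W ε t₀ t₁ x₀ x) ∧
    (∃ η, S.IsLeadingOrder P W t₀ t₁ x₀ η) ∧
    -- the sizes of the model uncertainty
    (∀ ε : ℝ, 0 ≤ ε → ∀ t ∈ Icc t₀ t₁,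
      S.modelUncertainty ε t₀ t x₀ = ε * |b| ∧ S.noiseUncertainty ε t₀ t x₀ = ε ^ 2 * σ ^ 2) ∧
    -- the mean-squared trajectory uncertainty
    (∀ ε : ℝ, 0 ≤ ε → ∀ x, S.IsTrajectory P W ε t₀ t₁ x₀ x → ∀ t ∈ Icc t₀ t₁,
      Integrable (fun ω ↦ |x t ω - ModelSensitivity.flow S.f₀ t₀ t x₀| ^ 2) P ∧
      (A ≠ 0 → ∫ ω, |x t ω - ModelSensitivity.flow S.f₀ t₀ t x₀| ^ 2 ∂P =
        ε ^ 2 * b ^ 2 / A ^ 2 * (Real.exp (A * (t - t₀)) - 1) ^ 2 +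
          ε ^ 2 * σ ^ 2 / (2 * A) * (Real.exp (2 * A * (t - t₀)) - 1)) ∧
      (b ≠ 0 → ∫ ω, |x t ω - ModelSensitivity.flow S.f₀ t₀ t x₀| ^ 2 ∂P =
        ε ^ 2 * b ^ 2 * ModelSensitivity.MS S.f₀ t₀ t x₀ (σ ^ 2 / b ^ 2))) ∧
    -- the bound on the mean-squared leading-order trajectory uncertainty is attained
    (∀ η, S.IsLeadingOrder P W t₀ t₁ x₀ η → ∀ ε : ℝ, 0 ≤ ε → ∀ t ∈ Icc t₀ t₁,
      Integrable (fun ω ↦ |η t ω| ^ 2) P ∧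
      ε ^ 2 * ∫ ω, |η t ω| ^ 2 ∂P =
        ModelSensitivity.leadingBound S.f₀ t₀ t x₀
          (S.modelUncertainty ε t₀ t x₀) (S.noiseUncertainty ε t₀ t x₀)) ∧
    -- it cannot be improved: no bound valid for all systems (not even one valid only for all scalar
    -- systems) is smaller at this idealized model, whatever the sizes of the uncertainty
    (∀ Φ : (ℝ → ℝ → ℝ) → ℝ → ℝ → ℝ → ℝ → ℝ → ℝ, ModelSensitivity.IsUniversalBound P Φ →
      ∀ t ∈ Icc t₀ t₁, ∀ Δ Δσ : ℝ, 0 ≤ Δ → 0 ≤ Δσ →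
        ModelSensitivity.leadingBound S.f₀ t₀ t x₀ Δ Δσ ≤ Φ S.f₀ t₀ t x₀ Δ Δσ) ∧
    -- and its constant `1` cannot be lowered
    (∀ c : ℝ, ModelSensitivity.IsUniversalBound P (fun f s t (x : ℝ) Δ Δσ ↦
        c * ModelSensitivity.leadingBound f s t x Δ Δσ) → 1 ≤ c) := by

  subst hS
  refine ⟨ModelSensitivity.scalarLinear_admissible A b σ t₀ t₁,
    fun ε _ ↦ ⟨_, ModelSensitivity.scalarLinear_isTrajectory_iff.2
      (hW.isSDESolution_linear A (ε * b) (ε * σ) x₀)⟩,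
    ⟨_, ModelSensitivity.scalarLinear_isLeadingOrder_iff.2 (hW.isSDESolution_linear A b σ 0)⟩,
    fun ε _ t ht ↦ ⟨ModelSensitivity.scalarLinear_modelUncertainty A b σ ε ht.1 x₀,
      ModelSensitivity.scalarLinear_noiseUncertainty A b σ ε ht.1 x₀⟩,
    fun ε _ x hx t ht ↦ ?_,
    fun η hη ε _ t ht ↦ ModelSensitivity.scalarLinear_integral_sq_leadingOrder hW hη ε ht,
    fun Φ hΦ t h Δ Δσ hΔ hΔσ ↦ hΦ.leadingBound_le hW ht A x₀ h hΔ hΔσ,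
    fun c hc ↦ ?_⟩
  · obtain ⟨h1, h2⟩ :=
      hW.integral_sq_linear (ModelSensitivity.scalarLinear_isTrajectory_iff.1 hx) ht
    have hflow : ModelSensitivity.flow (ModelSensitivity.scalarLinear A b σ).f₀ t₀ t x₀ =
        Real.exp (A * (t - t₀)) * x₀ := ModelSensitivity.flow_linear A ht.1 x₀
    rw [hflow]
    refine ⟨h1, fun hA ↦ ?_, fun hb ↦ ?_⟩
    · rw [h2, ModelSensitivity.integral_exp_mul_sub hA,
        ModelSensitivity.integral_exp_mul_sub (mul_ne_zero two_ne_zero hA)]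
      field_simp
    · rw [h2, ModelSensitivity.MS]
      simp only [ModelSensitivity.scalarLinear]
      rw [ModelSensitivity.stretchIntegral_linear A ht.1,
        ModelSensitivity.traceIntegral_linear A ht.1]
      field_simp
  -- At `Δ = 1`, `Δσ = 0`, `t = t₁` the bound is a positive number, which cancels from `B ≤ c B`.
  · have h := hc.leadingBound_le hW ht A x₀ (right_mem_Icc.2 ht.le) zero_le_one le_rfl
    have hpos := ModelSensitivity.leadingBound_linear_pos A x₀ ht
    exact le_of_mul_le_mul_right (by simpa using h) hpos
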